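/- Let $E$ be a finite-dimensional real vector space with a Euclidean norm $\|\cdot\|$, and for $q\ge 0$ put $f_q(x)=\|x\|^q$ (with $0^0=1$). The norm of a $p$-multilinear form $L$ on $E$ is $\|L\|=\max_{\|h_1\|=\dots=\|h_p\|=1}|L[h_1,\dots,h_p]|$. Define polynomials $g_{p,q}$ by $g_{0,q}=1$ and $g_{p,q}(\tau)=(1-\tau^2)g_{p-1,q}'(\tau)+(q-p+1)\,\tau\, g_{p-1,q}(\tau)$ for $p\ge1$. For an integer $p\ge 0$ and a real $\nu\in[0,1]$ let $$H_{p,\nu}=\sup_{0\le\tau_1<\tau_2\le1}\frac{g_{p,p+\nu}(\tau_2)-g_{p,p+\nu}(\tau_1)}{(\tau_2-\tau_1)^\nu}$$ be the $\nu$-Hölder constant of $g_{p,p+\nu}$ on $[0,1]$, and let $$A_{p,\nu}=\begin{cases}(p-1)!!\prod_{i=1}^{p/2}(\nu+2i)+H_{p,\nu},& p\text{ even},\\ 2^{1-\nu}\prod_{i=1}^{p}(\nu+i),& p\text{ odd},\end{cases}\qquad \tilde A_{p,\nu}=\begin{cases}(p-1)!!\prod_{i=1}^{p/2}(\nu+2i)+\prod_{i=1}^{p}(\nu+i),&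 p\text{ even},\\ 2^{1-\nu}\prod_{i=1}^{p}(\nu+i),& p\text{ odd},\end{cases}$$ where $(-1)!!=1$. Theorem. Let $p\ge0$ be an integer and $\nu\in[0,1]$. The function $f_{p+\nu}$ is $p$ times continuously differentiable on $E\setminus\{0\}$, and on all of $E$ if $\nu>0$ or $p$ is even; if $\nu=0$ and $p$ is odd, put $D^pf_{p}(0):=0$. The supremum $H_{p,\nu}$ is finite, and $$\|D^pf_{p+\nu}(x_2)-D^pf_{p+\nu}(x_1)\|\le A_{p,\nu}\,\|x_2-x_1\|^{\nu}\qquad\text{for all }x_1,x_2\in E.$$ Moreover $A_{p,\nu}\le\tilde A_{p,\nu}$, so the same inequality holds with $\tilde A_{p,\nu}$ in place of $A_{p,\nu}$. Suppose in addition that $E\ne\{0\}$. If $p$ is odd, then $\tilde A_{p,\nu}$ is optimal: every real $M$ with $\|D^pf_{p+\nu}(x_2)-D^pf_{p+\nu}(x_1)\|\le M\|x_2-x_1\|^\nu$ for all nonzero $x_1,x_2\in E$ satisfies $\tilde A_{p,\nu}\le M$. If $p$ is even and $\nu>0$, then $\tilde A_{p,\nu}$ is at most twice the optimal constant: every real $M$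 with $\|D^pf_{p+\nu}(x_2)-D^pf_{p+\nu}(x_1)\|\le M\|x_2-x_1\|^\nu$ for all $x_1,x_2\in E$ satisfies $\tilde A_{p,\nu}\le 2M$. -/

import Mathlib

noncomputable section

/-- The power `f_q(x) = ‖x‖ ^ q` of the Euclidean norm. -/
def normPow (E : Type*) [NormedAddCommGroup E] (q : ℝ) (x : E) : ℝ := ‖x‖ ^ q

/-- The polynomials `g_{p,q}`: `g_{0,q} = 1` and
`g_{p+1,q}(τ) = (1 - τ²) g_{p,q}'(τ) + (q - p) τ g_{p,q}(τ)`. -/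
def gPoly : ℕ → ℝ → Polynomial ℝ
  | 0, _ => 1
  | p + 1, q =>
      (1 - Polynomial.X ^ 2) * Polynomial.derivative (gPoly p q)
        + Polynomial.C (q - (p : ℝ)) * Polynomial.X * gPoly p q

/-- The quotients `(g(τ₂) - g(τ₁)) / (τ₂ - τ₁)^ν`, `0 ≤ τ₁ < τ₂ ≤ 1`, for `g = g_{p,p+ν}`. -/
def holderQuotients (p : ℕ) (ν : ℝ) : Set ℝ :=
  {r | ∃ s t : ℝ, 0 ≤ s ∧ s < t ∧ t ≤ 1 ∧
    r = ((gPoly p (p + ν)).eval t - (gPoly p (p + ν)).eval s) / (t - s) ^ ν}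

/-- `H_{p,ν}`, the `ν`-Hölder constant of `g_{p,p+ν}` on `[0,1]` (a supremum; for `ν = 1` it
need not be attained). -/
def hConst (p : ℕ) (ν : ℝ) : ℝ := sSup (holderQuotients p ν)

/-- The constant `A_{p,ν}`. For `p = 0` the truncated `p - 1 = 0` gives `0‼ = 1 = (-1)‼`. -/
def aConst (p : ℕ) (ν : ℝ) : ℝ :=
  if Even p then
    (Nat.doubleFactorial (p - 1) : ℝ) * ∏ i ∈ Finset.Icc 1 (p / 2), (ν + 2 * (i : ℝ))
      + hConst p ν
  else (2 : ℝ) ^ (1 - ν) * ∏ i ∈ Finset.Icc 1 p, (ν + (i : ℝ))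

/-- The explicit constant `Ã_{p,ν}`. -/
def aTildeConst (p : ℕ) (ν : ℝ) : ℝ :=
  if Even p then
    (Nat.doubleFactorial (p - 1) : ℝ) * ∏ i ∈ Finset.Icc 1 (p / 2), (ν + 2 * (i : ℝ))
      + ∏ i ∈ Finset.Icc 1 p, (ν + (i : ℝ))
  else (2 : ℝ) ^ (1 - ν) * ∏ i ∈ Finset.Icc 1 p, (ν + (i : ℝ))

/-- `F` is `ν`-Hölder continuous on `S` with (real) constant `M`. -/
def HolderOnWithConst {E G : Type*} [NormedAddCommGroup E] [NormedAddCommGroup G]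
    (M ν : ℝ) (F : E → G) (S : Set E) : Prop :=
  ∀ x₁ ∈ S, ∀ x₂ ∈ S, ‖F x₂ - F x₁‖ ≤ M * ‖x₂ - x₁‖ ^ ν

end

/-!
The `p`-th derivative of `‖x‖ ^ q` along a unit vector `h` is `g_{p,q}(τ) ‖x‖ ^ (q - p)`, where
`τ` is the cosine of the angle between `x` and `h`. A symmetric multilinear form attains its norm
on the diagonal (Banach), so the Hölder constant of the `p`-th derivative of `‖x‖ ^ (p + ν)` is
governed by these functions, and through concavity of `r ↦ r ^ ν` by the Hölder constant of
`g = g_{p,p+ν}` on `[0, 1]`; the parity of `p` decides how the half-spaces `τ ≥ 0` and `τ ≤ 0`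
are glued.

The point is then `g(t) - g(s) ≤ g(1) (t - s) ^ ν` for `0 ≤ s ≤ t ≤ 1`. At a maximiser of the
difference of the two sides, the first- and second-order conditions turn the Gegenbauer
differential equation for `g` into bounds on `g(s)` and `g(t)` that rule out a positive maximum.

Comparing the points `h` and `-h` shows that the constant is sharp for odd `p`; comparing `0` and
`h` gives the factor `2` for even `p`.
-/

namespace NormPower

open Filter Topology

section GegenbauerPolynomials

open Finset Polynomial

theorem gPoly_succ (p : ℕ) (q : ℝ) :
    gPoly (p + 1) q = (1 - X ^ 2) * derivative (gPoly p q) + C (q - (p : ℝ)) * X * gPoly p q := rfl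

theorem derivative_gPoly_succ_of_ode {p : ℕ} {q : ℝ}
    (h : (1 - X ^ 2) * derivative (derivative (gPoly p q))
      + C (q - 1) * X * derivative (gPoly p q) + C ((p : ℝ) * (p - q)) * gPoly p q = 0) :
    derivative (gPoly (p + 1) q)
      = C ((p : ℝ) + 1) * (C (q - p) * gPoly p q - X * derivative (gPoly p q)) := by
  rw [gPoly_succ]
  simp only [derivative_add, derivative_mul, derivative_sub, derivative_one, derivative_X_pow,
    derivative_X, derivative_C]
  simp only [map_sub, map_add, map_mul, map_one, Nat.cast_ofNat, map_ofNat] at h ⊢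
  linear_combination h

theorem gPoly_gegenbauer_ode (p : ℕ) (q : ℝ) :
    (1 - X ^ 2) * derivative (derivative (gPoly p q)) + C (q - 1) * X * derivative (gPoly p q)
      + C ((p : ℝ) * (p - q)) * gPoly p q = 0 := by
  induction p with
  | zero => simp [gPoly]
  | succ p ih =>
    rw [derivative_gPoly_succ_of_ode ih, gPoly_succ]
    simp only [derivative_mul, derivative_sub, derivative_X, derivative_C]
    push_cast
    simp only [map_sub, map_add, map_mul, map_one] at ih ⊢
    linear_combination (-(C (p : ℝ) + 1) * X) * ih

theorem mul_gPoly_sub_two (p : ℕ) (q : ℝ) :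
    C q * gPoly p (q - 2) = C (q - p) * gPoly p q - X * derivative (gPoly p q) := by
  induction p with
  | zero => simp [gPoly]
  | succ p ih =>
    have ode := gPoly_gegenbauer_ode p q
    have ih' := congrArg derivative ih
    rw [derivative_gPoly_succ_of_ode ode, gPoly_succ, gPoly_succ]
    simp only [derivative_mul, derivative_sub, derivative_X, derivative_C] at ih'
    push_cast
    simp only [map_sub, map_add, map_mul, map_one, map_ofNat] at ih ih' ode ⊢
    linear_combination (1 - X ^ 2) * ih' + (C q - 2 - C (p : ℝ)) * X * ih - X * ode

theorem derivative_gPoly_succ (p : ℕ) (q : ℝ) :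
    derivative (gPoly (p + 1) q) = C (((p : ℝ) + 1) * q) * gPoly p (q - 2) := by
  rw [derivative_gPoly_succ_of_ode (gPoly_gegenbauer_ode p q), ← mul_gPoly_sub_two, map_mul,
    mul_assoc]

theorem gPoly_comp_neg_X (p : ℕ) (q : ℝ) :
    (gPoly p q).comp (-X) = C ((-1) ^ p) * gPoly p q := by
  induction p with
  | zero => simp [gPoly]
  | succ p ih =>
    have ih' := congrArg derivative ih
    simp only [derivative_comp, derivative_neg, derivative_X, derivative_C_mul] at ih'
    rw [gPoly_succ, pow_succ (-1 : ℝ)]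
    simp only [add_comp, mul_comp, sub_comp, one_comp, pow_comp, X_comp, C_comp, ih, map_mul,
      map_neg, map_one]
    linear_combination (X ^ 2 - 1) * ih'

theorem gPoly_eval_neg (p : ℕ) (q t : ℝ) :
    (gPoly p q).eval (-t) = (-1) ^ p * (gPoly p q).eval t := by
  simpa using congrArg (eval t) (gPoly_comp_neg_X p q)

theorem prod_range_sub_eq_prod_Icc {M : Type*} [CommMonoid M] (n : ℕ) (f : ℝ → M) :
    ∏ i ∈ range n, f (n - i) = ∏ i ∈ Finset.Icc 1 n, f i := by
  refine prod_nbij' (n - ·) (n - ·) ?_ ?_ ?_ ?_ fun i hi => ?_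
  any_goals intro i hi; simp only [Finset.mem_range, Finset.mem_Icc] at hi ⊢; omega
  rw [Nat.cast_sub (Finset.mem_range.1 hi).le]

theorem gPoly_eval_one (p : ℕ) (q : ℝ) : (gPoly p q).eval 1 = ∏ i ∈ range p, (q - i) := by
  induction p with
  | zero => simp [gPoly]
  | succ p ih => simp [gPoly_succ, prod_range_succ, ← ih, mul_comm]

theorem gPoly_add_eval_one (p : ℕ) (ν : ℝ) :
    (gPoly p (p + ν)).eval 1 = ∏ i ∈ Finset.Icc 1 p, (ν + (i : ℝ)) := by
  rw [gPoly_eval_one, ← prod_range_sub_eq_prod_Icc p (ν + ·)]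
  exact prod_congr rfl fun i _ => by ring

theorem gPoly_add_two_eval_zero (p : ℕ) (q : ℝ) :
    (gPoly (p + 2) q).eval 0 = (p + 1) * (q - p) * (gPoly p q).eval 0 := by
  rw [gPoly_succ, derivative_gPoly_succ_of_ode (gPoly_gegenbauer_ode p q)]
  simp only [eval_add, eval_mul, eval_sub, eval_one, eval_pow, eval_X, eval_C]
  ring

theorem gPoly_eval_zero_of_odd {p : ℕ} (hp : Odd p) (q : ℝ) : (gPoly p q).eval 0 = 0 := by
  have h := gPoly_eval_neg p q 0
  rw [hp.neg_one_pow, neg_zero] at h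
  linarith

theorem gPoly_two_mul_eval_zero (k : ℕ) (q : ℝ) :
    (gPoly (2 * k) q).eval 0
      = (Nat.doubleFactorial (2 * k - 1) : ℝ) * ∏ i ∈ range k, (q - 2 * i) := by
  induction k with
  | zero => simp [gPoly]
  | succ k ih =>
    have h : (2 * (k + 1) - 1).doubleFactorial = (2 * k + 1) * (2 * k - 1).doubleFactorial := by
      cases k <;> rfl
    rw [mul_add_one, gPoly_add_two_eval_zero, ih, prod_range_succ, ← mul_add_one, h]
    push_cast
    ring

theorem gPoly_add_eval_zero_of_even {p : ℕ} (hp : Even p) (ν : ℝ) :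
    (gPoly p (p + ν)).eval 0 = (Nat.doubleFactorial (p - 1) : ℝ) *
      ∏ i ∈ Finset.Icc 1 (p / 2), (ν + 2 * (i : ℝ)) := by
  obtain ⟨k, rfl⟩ := even_iff_exists_two_mul.1 hp
  rw [gPoly_two_mul_eval_zero, Nat.mul_div_cancel_left k two_pos,
    ← prod_range_sub_eq_prod_Icc k (ν + 2 * ·)]
  push_cast
  exact congrArg _ (prod_congr rfl fun i _ => by ring)

theorem derivative_gPoly_self_of_even {p : ℕ} (hp : Even p) : derivative (gPoly p p) = 0 := by
  obtain ⟨k, rfl⟩ := even_iff_exists_two_mul.1 hp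
  induction k with
  | zero => simp [gPoly]
  | succ k ih =>
    have hq : ((2 * (k + 1) : ℕ) : ℝ) - 2 = (2 * k : ℕ) := by push_cast; ring
    rw [show 2 * (k + 1) = 2 * k + 1 + 1 by ring, derivative_gPoly_succ,
      show 2 * k + 1 + 1 = 2 * (k + 1) by ring, hq, gPoly_succ, ih (even_two_mul k)]
    simp

theorem gPoly_self_eval_of_even {p : ℕ} (hp : Even p) (s t : ℝ) :
    (gPoly p p).eval s = (gPoly p p).eval t := by
  rw [eq_C_of_derivative_eq_zero (derivative_gPoly_self_of_even hp)]
  simp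

theorem gPoly_eval_nonneg (p : ℕ) {q : ℝ} (hq : (p : ℝ) - 1 ≤ q) {t : ℝ}
    (ht : t ∈ Set.Icc (0 : ℝ) 1) : 0 ≤ (gPoly p q).eval t := by
  induction p using Nat.twoStepInduction generalizing q with
  | zero => simp [gPoly]
  | one => simpa [gPoly] using mul_nonneg (by simpa using hq) ht.1
  | more p ih₀ ih₁ =>
    push_cast at hq
    have h₀ := ih₀ (q := q - 2) (by linarith)
    have h₁ := ih₁ (q := q) (by push_cast; linarith)
    have ht₂ : 0 ≤ 1 - t ^ 2 := by nlinarith [ht.1, ht.2]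
    have hq₁ : 0 ≤ q - (p + 1 : ℕ) := by push_cast; linarith
    have hd : 0 ≤ (p + 1) * q :=
      mul_nonneg p.cast_add_one_pos.le (by linarith [p.cast_nonneg (α := ℝ)])
    rw [gPoly_succ, derivative_gPoly_succ]
    simp only [eval_add, eval_mul, eval_sub, eval_one, eval_pow, eval_X, eval_C]
    exact add_nonneg (mul_nonneg ht₂ (mul_nonneg hd h₀)) (mul_nonneg (mul_nonneg hq₁ ht.1) h₁)

theorem gPoly_monotoneOn (p : ℕ) {ν : ℝ} (hν : 0 ≤ ν) :
    MonotoneOn (gPoly p (p + ν)).eval (Set.Icc 0 1) := by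
  refine monotoneOn_of_deriv_nonneg (convex_Icc 0 1) (gPoly p (p + ν)).continuous.continuousOn
    (gPoly p (p + ν)).differentiable.differentiableOn fun t ht => ?_
  rw [Polynomial.deriv]
  rcases p with _ | p
  · simp [gPoly]
  · rw [derivative_gPoly_succ, eval_mul, eval_C]
    have := gPoly_eval_nonneg p (q := (p + 1 : ℕ) + ν - 2) (by push_cast; linarith)
      (interior_subset ht)
    positivity

end GegenbauerPolynomials

section HolderBound

open Polynomial Set

theorem nonpos_of_isLocalMax_of_hasDerivAt {f f' : ℝ → ℝ} {f'' x : ℝ} (h : IsLocalMax f x)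
    (hf : ∀ᶠ y in 𝓝 x, HasDerivAt f (f' y) y) (hf' : HasDerivAt f' f'' x) : f'' ≤ 0 := by
  have hd : deriv f =ᶠ[𝓝 x] f' := hf.mono fun y hy => hy.deriv
  have hdd : deriv (deriv f) x = f'' := by rw [hd.deriv_eq, hf'.deriv]
  by_contra! hpos
  have hmin := isLocalMin_of_deriv_deriv_pos (hdd ▸ hpos) h.deriv_eq_zero
    hf.self_of_nhds.continuousAt
  have hconst : f =ᶠ[𝓝 x] fun _ => f x := by
    filter_upwards [h, hmin] with y h₁ h₂ using le_antisymm h₁ h₂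
  have : deriv (deriv f) x = 0 := by simp [hconst.deriv.deriv_eq]
  exact hpos.ne (this ▸ hdd)

theorem hasDerivAt_mul_sub_rpow (σ a r : ℝ) {x : ℝ} (h : 0 < σ * (x - a)) :
    HasDerivAt (fun y => (σ * (y - a)) ^ r) (σ * (r * (σ * (x - a)) ^ (r - 1))) x := by
  have hlin : HasDerivAt (fun y => σ * (y - a)) σ x := by
    simpa using ((hasDerivAt_id x).sub_const a).const_mul σ
  simpa only [mul_assoc] using hlin.rpow_const (p := r) (Or.inl h.ne')

theorem derivative_eval_of_isLocalMax_sub_rpow {P : ℝ[X]} {σ a ν G x : ℝ} (hσ : σ ^ 2 = 1)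
    (hν0 : 0 ≤ ν) (hν1 : ν ≤ 1) (hG : 0 ≤ G) (hx : 0 < σ * (x - a))
    (h : IsLocalMax (fun y => σ * P.eval y - G * (σ * (y - a)) ^ ν) x) :
    (derivative P).eval x = G * (ν * (σ * (x - a)) ^ (ν - 1)) ∧
      σ * (derivative (derivative P)).eval x ≤ 0 := by
  have hder : ∀ y, 0 < σ * (y - a) →
      HasDerivAt (fun y => σ * P.eval y - G * (σ * (y - a)) ^ ν)
        (σ * (derivative P).eval y - G * (σ * (ν * (σ * (y - a)) ^ (ν - 1)))) y := fun y hy =>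
    ((P.hasDerivAt y).const_mul σ).sub ((hasDerivAt_mul_sub_rpow σ a ν hy).const_mul G)
  have hnear : ∀ᶠ y in 𝓝 x, 0 < σ * (y - a) :=
    (by fun_prop : Continuous fun y => σ * (y - a)).continuousAt.eventually (lt_mem_nhds hx)
  have hfirst := h.hasDerivAt_eq_zero (hder x hx)
  have hsecond := nonpos_of_isLocalMax_of_hasDerivAt h (hnear.mono hder)
    ((((derivative P).hasDerivAt x).const_mul σ).sub
      ((((hasDerivAt_mul_sub_rpow σ a (ν - 1) hx).const_mul ν).const_mul σ).const_mul G))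
  have hpos : 0 ≤ G * (ν * ((1 - ν) * (σ * (x - a)) ^ (ν - 1 - 1))) := by
    have := Real.rpow_nonneg hx.le (ν - 1 - 1)
    have := sub_nonneg.2 hν1
    positivity
  have hσ0 : σ ≠ 0 := by rintro rfl; norm_num at hσ
  refine ⟨mul_left_cancel₀ hσ0 (by linear_combination hfirst), ?_⟩
  linear_combination hsecond + hpos - G * ν * (1 - ν) * (σ * (x - a)) ^ (ν - 1 - 1) * hσ

theorem mul_gPoly_eval_le_of_isLocalMax {p : ℕ} {σ a ν G x : ℝ} (hσ : σ ^ 2 = 1) (hν0 : 0 < ν)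
    (hν1 : ν ≤ 1) (hG : 0 ≤ G) (hx : 0 < σ * (x - a)) (hx1 : x ^ 2 ≤ 1)
    (h : IsLocalMax (fun y => σ * (gPoly p (p + ν)).eval y - G * (σ * (y - a)) ^ ν) x) :
    σ * (p * (gPoly p (p + ν)).eval x)
      ≤ σ * ((p + ν - 1) * x * (G * (σ * (x - a)) ^ (ν - 1))) := by
  obtain ⟨hd, hdd⟩ := derivative_eval_of_isLocalMax_sub_rpow hσ hν0.le hν1 hG hx h
  have ode := congrArg (eval x) (gPoly_gegenbauer_ode p (p + ν))
  simp only [eval_add, eval_mul, eval_sub, eval_one, eval_pow, eval_X, eval_C, eval_zero, hd]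
    at ode
  have := mul_nonneg (sub_nonneg.2 hx1) (neg_nonneg.2 hdd)
  refine le_of_mul_le_mul_left ?_ hν0
  linear_combination this - σ * ode

theorem one_le_rpow_sub_one_mul {ν d : ℝ} (hν0 : 0 ≤ ν) (hν1 : ν ≤ 1) (hd : 0 < d) :
    1 ≤ d ^ (ν - 1) * (1 - (1 - ν) * (1 - d)) := by
  have bernoulli : d ^ (1 - ν) ≤ 1 + (1 - ν) * (d - 1) := by
    simpa using rpow_one_add_le_one_add_mul_self (s := d - 1) (p := 1 - ν) (by linarith)
      (by linarith) (by linarith)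
  calc (1 : ℝ) = d ^ (ν - 1) * d ^ (1 - ν) := by rw [← Real.rpow_add hd]; simp
    _ ≤ d ^ (ν - 1) * (1 - (1 - ν) * (1 - d)) := by gcongr; linarith

theorem mul_le_mul_gPoly_eval_of_isMaxOn {p : ℕ} {a b ν G : ℝ} (hν0 : 0 < ν) (hν1 : ν ≤ 1)
    (hG : 0 ≤ G) (ha : 0 ≤ a) (hab : a < b) (hb : b ≤ 1)
    (h : IsMaxOn (fun y => -(gPoly p (p + ν)).eval y - G * (b - y) ^ ν) (Icc 0 b) a) :
    (p + ν - 1) * a * (G * (b - a) ^ (ν - 1)) ≤ p * (gPoly p (p + ν)).eval a := by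
  rcases ha.eq_or_lt with rfl | ha
  · have := gPoly_eval_nonneg p (q := p + ν) (t := 0) (by linarith) (by simp)
    rw [mul_zero, zero_mul]
    positivity
  · have hmax := h.isLocalMax (Icc_mem_nhds ha hab)
    simpa using mul_gPoly_eval_le_of_isLocalMax (p := p) (σ := -1) (x := a) (a := b) (by norm_num)
      hν0 hν1 hG (by linarith) (by nlinarith) (by simpa using hmax)

theorem mul_gPoly_eval_le_of_isMaxOn {p : ℕ} {a b ν G : ℝ} (hν0 : 0 < ν) (hν1 : ν ≤ 1)
    (hG : 0 ≤ G) (ha : 0 ≤ a) (hab : a < b) (hb : b < 1)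
    (h : IsMaxOn (fun y => (gPoly p (p + ν)).eval y - G * (y - a) ^ ν) (Icc a 1) b) :
    p * (gPoly p (p + ν)).eval b ≤ (p + ν - 1) * b * (G * (b - a) ^ (ν - 1)) := by
  have hmax := h.isLocalMax (Icc_mem_nhds hab hb)
  simpa using mul_gPoly_eval_le_of_isLocalMax (p := p) (σ := 1) (x := b) (a := a) (by norm_num)
    hν0 hν1 hG (by linarith) (by nlinarith) (by simpa using hmax)

theorem gPoly_eval_sub_le_of_isMaxOn {p : ℕ} (hp : 1 ≤ p) {ν : ℝ} (hν0 : 0 < ν) (hν1 : ν ≤ 1)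
    {a b : ℝ} (ha : 0 ≤ a) (hab : a < b) (hb : b ≤ 1)
    (hmaxa : IsMaxOn (fun y => -(gPoly p (p + ν)).eval y
      - (gPoly p (p + ν)).eval 1 * (b - y) ^ ν) (Icc 0 b) a)
    (hmaxb : IsMaxOn (fun y => (gPoly p (p + ν)).eval y
      - (gPoly p (p + ν)).eval 1 * (y - a) ^ ν) (Icc a 1) b) :
    (gPoly p (p + ν)).eval b - (gPoly p (p + ν)).eval a
      ≤ (gPoly p (p + ν)).eval 1 * (b - a) ^ ν := by
  have hG : 0 ≤ (gPoly p (p + ν)).eval 1 := gPoly_eval_nonneg p (by linarith) (by simp)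
  have hd : 0 < b - a := sub_pos.2 hab
  have hp1 : (1 : ℝ) ≤ p := by exact_mod_cast hp
  have hleft := mul_le_mul_gPoly_eval_of_isMaxOn hν0 hν1 hG ha hab hb hmaxa
  have hright := mul_gPoly_eval_le_of_isMaxOn hν0 hν1 hG ha hab (h := hmaxb)
  have hbernoulli := one_le_rpow_sub_one_mul hν0.le hν1 hd
  have hD1 : b - a ≤ 1 → 1 ≤ (b - a) ^ (ν - 1) := fun h =>
    Real.one_le_rpow_of_pos_of_le_one_of_nonpos hd h (by linarith)
  have hdD : (b - a) ^ ν = (b - a) ^ (ν - 1) * (b - a) := by rw [← Real.rpow_add_one hd.ne']; simp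
  refine le_of_mul_le_mul_left ?_ (zero_lt_one.trans_le hp1)
  rw [hdD]
  set D := (b - a) ^ (ν - 1)
  rcases hb.lt_or_eq with hb | rfl
  · have : 0 ≤ (1 - ν) * ((gPoly p (p + ν)).eval 1 * (D * (b - a))) :=
      mul_nonneg (by linarith) (by positivity)
    linarith [hright hb]
  · have hkey : p ≤ (p + ν - 1) * a * D + p * D * (1 - a) := by
      nlinarith [hD1 (by linarith)]
    linarith [mul_le_mul_of_nonneg_left hkey hG]

theorem gPoly_eval_sub_le (p : ℕ) {ν : ℝ} (hν0 : 0 ≤ ν) (hν1 : ν ≤ 1) {s t : ℝ} (hs : 0 ≤ s)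
    (hst : s ≤ t) (ht : t ≤ 1) :
    (gPoly p (p + ν)).eval t - (gPoly p (p + ν)).eval s
      ≤ (gPoly p (p + ν)).eval 1 * (t - s) ^ ν := by
  rcases hν0.eq_or_lt with rfl | hνpos
  · have h₁ := gPoly_monotoneOn p le_rfl ⟨hs.trans hst, ht⟩ (by simp) ht
    have h₂ := gPoly_eval_nonneg p (q := p + 0) (by simp) ⟨hs, hst.trans ht⟩
    rw [Real.rpow_zero]
    linarith
  rcases p.eq_zero_or_pos with rfl | hp
  · simpa [gPoly] using Real.rpow_nonneg (sub_nonneg.2 hst) ν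
  set g := gPoly p (p + ν)
  let Δ : ℝ × ℝ → ℝ := fun z => g.eval z.2 - g.eval z.1 - g.eval 1 * (z.2 - z.1) ^ ν
  let K : Set (ℝ × ℝ) := (Icc 0 1 ×ˢ Icc 0 1) ∩ {z | z.1 ≤ z.2}
  have hK : IsCompact K := (isCompact_Icc.prod isCompact_Icc).inter_right
    (isClosed_le continuous_fst continuous_snd)
  have hΔ : Continuous Δ := by fun_prop (disch := simp [hν0])
  have hmem : (s, t) ∈ K := ⟨⟨⟨hs, hst.trans ht⟩, ⟨hs.trans hst, ht⟩⟩, hst⟩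
  obtain ⟨⟨a, b⟩, ⟨⟨⟨ha0, ha1⟩, ⟨hb0, hb1⟩⟩, hab⟩, hmax⟩ :=
    hK.exists_isMaxOn ⟨_, hmem⟩ hΔ.continuousOn
  suffices Δ (a, b) ≤ 0 from sub_nonpos.1 ((hmax hmem).trans this)
  rcases (show a ≤ b from hab).eq_or_lt with rfl | hab
  · simp [Δ, hνpos.ne']
  · refine sub_nonpos.2 (gPoly_eval_sub_le_of_isMaxOn hp hνpos hν1 ha0 hab hb1 ?_ ?_)
    · intro y hy
      have : Δ (y, b) ≤ Δ (a, b) := hmax ⟨⟨⟨hy.1, hy.2.trans hb1⟩, ⟨hb0, hb1⟩⟩, hy.2⟩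
      simp only [Δ] at this
      simp only [mem_ofPred_eq]
      linarith
    · intro y hy
      have : Δ (a, y) ≤ Δ (a, b) := hmax ⟨⟨⟨ha0, ha1⟩, ⟨ha0.trans hy.1, hy.2⟩⟩, hy.1⟩
      simp only [Δ] at this
      simp only [mem_ofPred_eq]
      linarith

end HolderBound

section HolderEstimates

open Set

variable {g : ℝ → ℝ} {H ν : ℝ}

theorem holderOnWithConst_of_sub_le {E : Type*} [NormedAddCommGroup E] {S : Set E} {F : E → ℝ}
    (hF : ∀ x ∈ S, ∀ y ∈ S, F y - F x ≤ H * ‖y - x‖ ^ ν) : HolderOnWithConst H ν F S := by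
  refine fun x hx y hy => abs_sub_le_iff.2 ⟨hF x hx y hy, ?_⟩
  rw [norm_sub_rev]
  exact hF y hy x hx

theorem holderOnWithConst_mono {E G : Type*} [NormedAddCommGroup E] [NormedAddCommGroup G]
    {F : E → G} {S : Set E} {M M' : ℝ} (hF : HolderOnWithConst M ν F S) (hM : M ≤ M') :
    HolderOnWithConst M' ν F S :=
  fun x hx y hy => (hF x hx y hy).trans (by gcongr)

theorem nonneg_of_holderOnWithConst (hF : HolderOnWithConst H ν g (Icc 0 1)) : 0 ≤ H := by
  have := (norm_nonneg _).trans (hF 0 (by simp) 1 (by simp))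
  simpa using this

theorem holderOnWithConst_norm_rpow {E : Type*} [NormedAddCommGroup E] (hν0 : 0 ≤ ν) (hν1 : ν ≤ 1) :
    HolderOnWithConst 1 ν (fun x : E => ‖x‖ ^ ν) univ := by
  refine holderOnWithConst_of_sub_le fun x _ y _ => ?_
  rw [one_mul, sub_le_iff_le_add]
  calc ‖y‖ ^ ν ≤ (‖y - x‖ + ‖x‖) ^ ν := by
        gcongr; simpa using norm_add_le (y - x) x
    _ ≤ ‖y - x‖ ^ ν + ‖x‖ ^ ν :=
        Real.rpow_add_le_add_rpow (norm_nonneg _) (norm_nonneg _) hν0 hν1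

theorem rpow_add_rpow_le_two_rpow_mul {a b : ℝ} (ha : 0 ≤ a) (hb : 0 ≤ b) (hν0 : 0 ≤ ν)
    (hν1 : ν ≤ 1) : a ^ ν + b ^ ν ≤ 2 ^ (1 - ν) * (a + b) ^ ν := by
  have hconc : 1 / 2 * a ^ ν + 1 / 2 * b ^ ν ≤ (1 / 2 * a + 1 / 2 * b) ^ ν :=
    (Real.concaveOn_rpow hν0 hν1).2 ha hb (by norm_num) (by norm_num) (by norm_num)
  rw [← mul_add, ← mul_add, Real.mul_rpow (by norm_num) (add_nonneg ha hb)] at hconc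
  rw [Real.rpow_sub two_pos, Real.rpow_one, div_eq_mul_inv, ← Real.inv_rpow two_pos.le,
    ← one_div (2 : ℝ)]
  linarith

theorem mul_rpow_sub_mul_rpow_le (hν0 : 0 ≤ ν) (hν1 : ν ≤ 1) (hg : MonotoneOn g (Icc 0 1))
    (hg0 : g 0 = 0) (hH : HolderOnWithConst H ν g (Icc 0 1)) {m b ρ R : ℝ} (hm : 0 ≤ m)
    (hmb : m ≤ b) (hb : b ≤ 1) (hρ : 0 ≤ ρ) (hρR : ρ ≤ R) :
    g b * R ^ ν - g m * ρ ^ ν ≤ H * (R * b - ρ * m) ^ ν := by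
  have hR : 0 ≤ R := hρ.trans hρR
  obtain ⟨r, hr0, hr1, rfl⟩ : ∃ r, 0 ≤ r ∧ r ≤ 1 ∧ ρ = R * r := by
    rcases hR.eq_or_lt with rfl | hR
    · exact ⟨0, le_rfl, zero_le_one, by linarith⟩
    · exact ⟨ρ / R, by positivity, div_le_one_of_le₀ hρR hR.le, (mul_div_cancel₀ _ hR.ne').symm⟩
  have hm1 : m ∈ Icc (0 : ℝ) 1 := ⟨hm, hmb.trans hb⟩
  have hb1 : b ∈ Icc (0 : ℝ) 1 := ⟨hm.trans hmb, hb⟩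
  have hgm : 0 ≤ g m := hg0 ▸ hg (by simp) hm1 hm
  have hgb : g b ≤ H * b ^ ν := by
    simpa [hg0, abs_of_nonneg hb1.1] using (le_abs_self _).trans (hH 0 (by simp) b hb1)
  have hgmb : g b - g m ≤ H * (b - m) ^ ν := by
    simpa [abs_of_nonneg (sub_nonneg.2 hmb)] using (le_abs_self _).trans (hH m hm1 b hb1)
  have hconc : (1 - r) * b ^ ν + r * (b - m) ^ ν ≤ (b - r * m) ^ ν := by
    have := (Real.concaveOn_rpow hν0 hν1).2 (x := b) (y := b - m) hb1.1 (sub_nonneg.2 hmb)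
      (sub_nonneg.2 hr1) hr0 (by ring)
    simp only [smul_eq_mul] at this
    rwa [show (1 - r) * b + r * (b - m) = b - r * m by ring] at this
  have hrν : r ≤ r ^ ν := Real.self_le_rpow_of_le_one hr0 hr1 hν1
  have hunit : g b - g m * r ^ ν ≤ H * (b - r * m) ^ ν := by
    linarith [mul_le_mul_of_nonneg_left hconc (nonneg_of_holderOnWithConst hH),
      mul_le_mul_of_nonneg_left hrν hgm, mul_le_mul_of_nonneg_left hgb (sub_nonneg.2 hr1),
      mul_le_mul_of_nonneg_left hgmb hr0]
  calc g b * R ^ ν - g m * (R * r) ^ ν = R ^ ν * (g b - g m * r ^ ν) := by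
        rw [Real.mul_rpow hR hr0]; ring
    _ ≤ R ^ ν * (H * (b - r * m) ^ ν) := by gcongr
    _ = H * (R * b - R * r * m) ^ ν := by
        rw [show R * b - R * r * m = R * (b - r * m) by ring,
          Real.mul_rpow hR (by nlinarith)]
        ring

end HolderEstimates

section AxialFunctions

open Set
open scoped RealInnerProductSpace

variable {E : Type*} [NormedAddCommGroup E] [InnerProductSpace ℝ E]

/-- The positively `s`-homogeneous function `x ↦ g(τ) ‖x‖ ^ s`, where `τ = ⟪x, h⟫ / ‖x‖` is the
cosine of the angle between `x` and a unit vector `h`. The `p`-th directional derivatives of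
`normPow E q` have this form, with `g = g_{p,q}` and `s = q - p`. -/
noncomputable def axial (g : ℝ → ℝ) (s : ℝ) (h x : E) : ℝ := g (⟪x, h⟫ / ‖x‖) * ‖x‖ ^ s

variable {h : E} {g : ℝ → ℝ} {H ν : ℝ}

theorem abs_inner_div_norm_le_one (hh : ‖h‖ = 1) (x : E) : |⟪x, h⟫ / ‖x‖| ≤ 1 := by
  simpa [hh] using abs_real_inner_div_norm_mul_norm_le_one x h

theorem norm_mul_abs_inner_div_norm (h x : E) : ‖x‖ * |⟪x, h⟫ / ‖x‖| = |⟪x, h⟫| := by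
  rcases eq_or_ne x 0 with rfl | hx
  · simp
  · rw [abs_div, abs_norm, mul_div_cancel₀ _ (norm_ne_zero_iff.2 hx)]

theorem abs_inner_le_norm_of_norm_eq_one (hh : ‖h‖ = 1) (x : E) : |⟪x, h⟫| ≤ ‖x‖ := by
  simpa [hh] using abs_real_inner_le_norm x h

theorem norm_sub_rescale_le {x y : E} (hxy : ‖y‖ ≤ ‖x‖) :
    ‖y - (‖y‖ / ‖x‖) • x‖ ≤ ‖y - x‖ := by
  rcases eq_or_ne x 0 with rfl | hx
  · simp
  have hr : ‖y‖ / ‖x‖ * ‖x‖ = ‖y‖ := div_mul_cancel₀ _ (norm_ne_zero_iff.2 hx)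
  have hr1 : ‖y‖ / ‖x‖ ≤ 1 := div_le_one_of_le₀ hxy (norm_nonneg x)
  set r := ‖y‖ / ‖x‖
  have hinner := mul_le_mul_of_nonneg_left (real_inner_le_norm y x) (sub_nonneg.2 hr1)
  refine le_of_sq_le_sq ?_ (norm_nonneg _)
  rw [norm_sub_sq_real, norm_sub_sq_real, norm_smul, inner_smul_right, Real.norm_eq_abs, mul_pow,
    sq_abs, ← mul_pow, hr]
  nlinarith [sq_nonneg (‖x‖ - ‖y‖), congrArg (· * ‖y‖) hr]

theorem norm_mul_sub_min_mul_min_le (hh : ‖h‖ = 1) (x y : E) :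
    ‖y‖ * |⟪y, h⟫ / ‖y‖| - min ‖x‖ ‖y‖ * min |⟪x, h⟫ / ‖x‖| |⟪y, h⟫ / ‖y‖| ≤ ‖y - x‖ := by
  have hnorm := norm_sub_norm_le y x
  have hinner (z w : E) : |⟪z, h⟫| - |⟪w, h⟫| ≤ ‖z - w‖ :=
    (abs_sub_abs_le_abs_sub _ _).trans <| by
      rw [← inner_sub_left]; exact abs_inner_le_norm_of_norm_eq_one hh _
  rcases le_total ‖x‖ ‖y‖ with hxy | hxy <;>
  rcases le_total |⟪x, h⟫ / ‖x‖| |⟪y, h⟫ / ‖y‖| with hab | hab <;>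
  simp only [min_eq_left hxy, min_eq_left hab, min_eq_right hxy, min_eq_right hab]
  · simpa only [norm_mul_abs_inner_div_norm] using hinner y x
  · rw [← sub_mul]
    exact (mul_le_of_le_one_right (sub_nonneg.2 hxy) (abs_inner_div_norm_le_one hh y)).trans hnorm
  · calc ‖y‖ * |⟪y, h⟫ / ‖y‖| - ‖y‖ * |⟪x, h⟫ / ‖x‖|
        = |⟪y, h⟫| - |⟪(‖y‖ / ‖x‖) • x, h⟫| := by
          rw [norm_mul_abs_inner_div_norm, real_inner_smul_left, div_mul_comm, mul_comm, abs_mul,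
            abs_norm]
      _ ≤ ‖y - (‖y‖ / ‖x‖) • x‖ := hinner _ _
      _ ≤ ‖y - x‖ := norm_sub_rescale_le hxy
  · simp

theorem holderOnWithConst_axial_abs (hν0 : 0 ≤ ν) (hν1 : ν ≤ 1) (hg : MonotoneOn g (Icc 0 1))
    (hg0 : g 0 = 0) (hH : HolderOnWithConst H ν g (Icc 0 1)) (hh : ‖h‖ = 1) :
    HolderOnWithConst H ν (axial (fun t => g |t|) ν h) univ := by
  refine holderOnWithConst_of_sub_le fun x _ y _ => ?_
  set a := |⟪x, h⟫ / ‖x‖|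
  set b := |⟪y, h⟫ / ‖y‖|
  have ha : a ∈ Icc (0 : ℝ) 1 := ⟨abs_nonneg _, abs_inner_div_norm_le_one hh x⟩
  have hb : b ∈ Icc (0 : ℝ) 1 := ⟨abs_nonneg _, abs_inner_div_norm_le_one hh y⟩
  have hm : 0 ≤ min a b := le_min ha.1 hb.1
  have hρ : 0 ≤ min ‖x‖ ‖y‖ := by positivity
  have hga : 0 ≤ g a := hg0 ▸ hg (by simp) ha ha.1
  have hgm : g (min a b) ≤ g a := hg ⟨hm, (min_le_left a b).trans ha.2⟩ ha (min_le_left a b)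
  have hnonneg : 0 ≤ ‖y‖ * b - min ‖x‖ ‖y‖ * min a b :=
    sub_nonneg.2 (mul_le_mul (min_le_right _ _) (min_le_right a b) hm (norm_nonneg y))
  calc g b * ‖y‖ ^ ν - g a * ‖x‖ ^ ν
      ≤ g b * ‖y‖ ^ ν - g (min a b) * min ‖x‖ ‖y‖ ^ ν := by gcongr; exact min_le_left _ _
    _ ≤ H * (‖y‖ * b - min ‖x‖ ‖y‖ * min a b) ^ ν := mul_rpow_sub_mul_rpow_le hν0 hν1 hg hg0 hH
        hm (min_le_right a b) hb.2 hρ (min_le_right _ _)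
    _ ≤ H * ‖y - x‖ ^ ν := by
        have := nonneg_of_holderOnWithConst hH
        gcongr
        exact norm_mul_sub_min_mul_min_le hh x y

theorem holderOnWithConst_axial_of_even (hν0 : 0 ≤ ν) (hν1 : ν ≤ 1) (hg : MonotoneOn g (Icc 0 1))
    (hg0 : 0 ≤ g 0) (heven : g.Even) (hH : HolderOnWithConst H ν g (Icc 0 1)) (hh : ‖h‖ = 1) :
    HolderOnWithConst (g 0 + H) ν (axial g ν h) univ := by
  have habs := holderOnWithConst_axial_abs (g := fun t => g t - g 0) hν0 hν1
    (fun s hs t ht hst => sub_le_sub_right (hg hs ht hst) _) (sub_self _)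
    (by simpa [HolderOnWithConst] using hH) hh
  have hdecomp (x : E) : axial g ν h x = g 0 * ‖x‖ ^ ν + axial (fun t => g |t| - g 0) ν h x := by
    have hg_abs (t : ℝ) : g |t| = g t := by
      rcases abs_choice t with ht | ht <;> simp [ht, heven t]
    simp only [axial, hg_abs]
    ring
  intro x hx y hy
  calc ‖axial g ν h y - axial g ν h x‖
      = ‖g 0 * (‖y‖ ^ ν - ‖x‖ ^ ν)
          + (axial (fun t => g |t| - g 0) ν h y - axial (fun t => g |t| - g 0) ν h x)‖ := by
        rw [hdecomp, hdecomp]; ring_nf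
    _ ≤ g 0 * (1 * ‖y - x‖ ^ ν) + H * ‖y - x‖ ^ ν := by
        refine (norm_add_le _ _).trans (add_le_add ?_ (habs x hx y hy))
        rw [norm_mul, Real.norm_of_nonneg hg0]
        exact mul_le_mul_of_nonneg_left (holderOnWithConst_norm_rpow hν0 hν1 x hx y hy) hg0
    _ = (g 0 + H) * ‖y - x‖ ^ ν := by ring

theorem abs_axial_le (hH : HolderOnWithConst H ν g (Icc 0 1)) (hodd : g.Odd)
    (hh : ‖h‖ = 1) (x : E) : |axial g ν h x| ≤ H * |⟪x, h⟫| ^ ν := by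
  have hg0 : g 0 = 0 := hodd.map_zero
  have hg_abs (t : ℝ) : |g t| = |g (|t|)| := by
    rcases abs_choice t with ht | ht <;> simp [ht, hodd t]
  have hb : |⟪x, h⟫ / ‖x‖| ∈ Icc (0 : ℝ) 1 := ⟨abs_nonneg _, abs_inner_div_norm_le_one hh x⟩
  have hgb : |g (⟪x, h⟫ / ‖x‖)| ≤ H * |⟪x, h⟫ / ‖x‖| ^ ν := by
    simpa [hg_abs (⟪x, h⟫ / ‖x‖), hg0] using hH 0 (by simp) _ hb
  calc |axial g ν h x| = |g (⟪x, h⟫ / ‖x‖)| * ‖x‖ ^ ν := by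
        rw [axial, abs_mul, abs_of_nonneg (Real.rpow_nonneg (norm_nonneg x) ν)]
    _ ≤ H * |⟪x, h⟫ / ‖x‖| ^ ν * ‖x‖ ^ ν := by gcongr
    _ = H * |⟪x, h⟫| ^ ν := by
        rw [mul_assoc, ← Real.mul_rpow (abs_nonneg _) (norm_nonneg x), mul_comm |_|,
          norm_mul_abs_inner_div_norm]

theorem axial_of_inner_nonneg {x : E} (hx : 0 ≤ ⟪x, h⟫) :
    axial g ν h x = axial (fun t => g |t|) ν h x := by
  rw [axial, axial, abs_of_nonneg (by positivity)]

theorem axial_of_inner_nonpos (hodd : g.Odd) {x : E} (hx : ⟪x, h⟫ ≤ 0) :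
    axial g ν h x = -axial (fun t => g |t|) ν h x := by
  rw [axial, axial, abs_of_nonpos (div_nonpos_of_nonpos_of_nonneg hx (norm_nonneg x)), hodd,
    neg_mul, neg_neg]

theorem norm_axial_sub_le_of_inner_mul_nonpos (hν0 : 0 ≤ ν) (hν1 : ν ≤ 1)
    (hH : HolderOnWithConst H ν g (Icc 0 1)) (hodd : g.Odd) (hh : ‖h‖ = 1) {x y : E}
    (hxy : ⟪x, h⟫ * ⟪y, h⟫ ≤ 0) :
    ‖axial g ν h y - axial g ν h x‖ ≤ 2 ^ (1 - ν) * H * ‖y - x‖ ^ ν := by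
  have hH0 := nonneg_of_holderOnWithConst hH
  have hsum : |⟪y, h⟫| + |⟪x, h⟫| ≤ ‖y - x‖ := by
    refine le_trans (le_of_eq ?_) (abs_inner_le_norm_of_norm_eq_one hh (y - x))
    rw [inner_sub_left, sub_eq_add_neg, ← abs_neg ⟪x, h⟫, eq_comm, abs_add_eq_add_abs_iff]
    rcases mul_nonpos_iff.1 hxy with hs | hs
    · exact Or.inr ⟨hs.2, neg_nonpos.2 hs.1⟩
    · exact Or.inl ⟨hs.2, neg_nonneg.2 hs.1⟩
  calc ‖axial g ν h y - axial g ν h x‖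
      ≤ H * |⟪y, h⟫| ^ ν + H * |⟪x, h⟫| ^ ν := (norm_sub_le _ _).trans
        (add_le_add (abs_axial_le hH hodd hh y) (abs_axial_le hH hodd hh x))
    _ = H * (|⟪y, h⟫| ^ ν + |⟪x, h⟫| ^ ν) := by ring
    _ ≤ H * (2 ^ (1 - ν) * (|⟪y, h⟫| + |⟪x, h⟫|) ^ ν) := by
        gcongr
        exact rpow_add_rpow_le_two_rpow_mul (abs_nonneg _) (abs_nonneg _) hν0 hν1
    _ ≤ H * (2 ^ (1 - ν) * ‖y - x‖ ^ ν) := by gcongr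
    _ = 2 ^ (1 - ν) * H * ‖y - x‖ ^ ν := by ring

theorem holderOnWithConst_axial_of_odd (hν0 : 0 ≤ ν) (hν1 : ν ≤ 1) (hg : MonotoneOn g (Icc 0 1))
    (hodd : g.Odd) (hH : HolderOnWithConst H ν g (Icc 0 1)) (hh : ‖h‖ = 1) :
    HolderOnWithConst (2 ^ (1 - ν) * H) ν (axial g ν h) univ := by
  have hg0 : g 0 = 0 := hodd.map_zero
  have habs := holderOnWithConst_axial_abs hν0 hν1 hg hg0 hH hh
  have hle : H ≤ 2 ^ (1 - ν) * H := le_mul_of_one_le_left (nonneg_of_holderOnWithConst hH)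
    (Real.one_le_rpow one_le_two (sub_nonneg.2 hν1))
  intro x hx y hy
  rcases le_total 0 ⟪x, h⟫ with hxh | hxh <;> rcases le_total 0 ⟪y, h⟫ with hyh | hyh
  · rw [axial_of_inner_nonneg hxh, axial_of_inner_nonneg hyh]
    exact (habs x hx y hy).trans (by gcongr)
  · exact norm_axial_sub_le_of_inner_mul_nonpos hν0 hν1 hH hodd hh
      (mul_nonpos_of_nonneg_of_nonpos hxh hyh)
  · exact norm_axial_sub_le_of_inner_mul_nonpos hν0 hν1 hH hodd hh
      (mul_nonpos_of_nonpos_of_nonneg hxh hyh)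
  · rw [axial_of_inner_nonpos hodd hxh, axial_of_inner_nonpos hodd hyh, neg_sub_neg, norm_sub_rev]
    exact (habs x hx y hy).trans (by gcongr)

end AxialFunctions

section SymmetricMultilinearForms

open Function
open scoped RealInnerProductSpace

theorem sum_update_update {ι G : Type*} [Fintype ι] [DecidableEq ι] [AddCommGroup G] (v : ι → G)
    {i j : ι} (hij : i ≠ j) (x y : G) :
    ∑ k, update (update v i x) j y k = ∑ k, v k + (x + y - (v i + v j)) := by
  rw [← sub_eq_iff_eq_add', ← Finset.sum_sub_distrib,
    Fintype.sum_eq_add i j hij fun k hk => by simp [hk.1, hk.2]]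
  simp only [update_self, update_of_ne hij]
  abel

variable {ι E : Type*} [NormedAddCommGroup E] [InnerProductSpace ℝ E]

theorem mul_norm_add_sq_le_abs_bilinForm {B : LinearMap.BilinForm ℝ E} (hB : B.IsSymm) {M : ℝ}
    (hM : ∀ x, |B x x| ≤ M * ‖x‖ ^ 2) {a b : E} (ha : ‖a‖ = 1) (hb : ‖b‖ = 1)
    (hab : M ≤ |B a b|) : M * ‖a + b‖ ^ 2 ≤ |B (a + b) (a + b)| := by
  have hpolar : 4 * B a b = B (a + b) (a + b) - B (a - b) (a - b) := by
    simp only [map_add, map_sub, LinearMap.add_apply, LinearMap.sub_apply, hB.eq b a]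
    ring
  have habs : 4 * |B a b| ≤ |B (a + b) (a + b)| + |B (a - b) (a - b)| := by
    rw [← abs_of_pos (four_pos (α := ℝ)), ← abs_mul, hpolar]
    exact abs_sub _ _
  have hpar := parallelogram_law_with_norm ℝ a b
  rw [ha, hb] at hpar
  linear_combination 4 * hab + habs + hM (a - b) + M * hpar

/-- The bilinear form `(x, y) ↦ L[v₁, …, x, …, y, …]` obtained from a multilinear form `L` by
freezing all arguments except those in the slots `i ≠ j`. -/
noncomputable def slotForm [DecidableEq ι] (L : ContinuousMultilinearMap ℝ (fun _ : ι => E) ℝ)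
    (v : ι → E) {i j : ι} (hij : i ≠ j) : LinearMap.BilinForm ℝ E :=
  LinearMap.mk₂ ℝ (fun x y => L (update (update v i x) j y))
    (fun x x' y => by simp only [update_comm hij, L.map_update_add])
    (fun c x y => by simp only [update_comm hij, L.map_update_smul])
    (fun x y y' => by simp only [L.map_update_add])
    (fun c x y => by simp only [L.map_update_smul])

theorem slotForm_isSymm [DecidableEq ι] {L : ContinuousMultilinearMap ℝ (fun _ : ι => E) ℝ}
    (hL : ∀ (σ : Equiv.Perm ι) (v : ι → E), L (v ∘ σ) = L v) (v : ι → E) {i j : ι} (hij : i ≠ j) :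
    (slotForm L v hij).IsSymm := by
  refine ⟨fun x y => ?_⟩
  simp only [slotForm, LinearMap.mk₂_apply]
  rw [← hL (Equiv.swap i j)]
  congr 1
  ext k
  rcases eq_or_ne k i with rfl | hki
  · simp [hij]
  rcases eq_or_ne k j with rfl | hkj
  · simp [hij]
  simp [Equiv.swap_apply_of_ne_of_ne hki hkj, hki, hkj]

variable [Fintype ι] {L : ContinuousMultilinearMap ℝ (fun _ : ι => E) ℝ} {v : ι → E}

theorem opNorm_le_of_forall_norm_eq_one {M : ℝ} (hM : 0 ≤ M)
    (hL : ∀ v : ι → E, (∀ i, ‖v i‖ = 1) → |L v| ≤ M) : ‖L‖ ≤ M := by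
  refine L.opNorm_le_bound hM fun v => ?_
  by_cases hv : ∃ i, v i = 0
  · obtain ⟨i, hi⟩ := hv
    rw [L.map_coord_zero i hi, norm_zero]
    positivity
  · push Not at hv
    have hunit := hL (fun i => ‖v i‖⁻¹ • v i) fun i => by simp [norm_smul, hv i]
    rw [L.map_smul_univ, smul_eq_mul, abs_mul, Finset.prod_inv_distrib, abs_inv,
      abs_of_nonneg (by positivity), inv_mul_eq_div] at hunit
    exact (div_le_iff₀ (Finset.prod_pos fun i _ => norm_pos_iff.2 (hv i))).1 hunit

variable (L) in
/-- The tuples of unit vectors at which the multilinear form `L` attains its norm. -/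
def normingTuples : Set (ι → E) := {v | (∀ i, ‖v i‖ = 1) ∧ |L v| = ‖L‖}

theorem abs_le_opNorm_of_forall_norm_eq_one (hv : ∀ i, ‖v i‖ = 1) : |L v| ≤ ‖L‖ := by
  simpa [hv] using L.le_opNorm v

theorem isCompact_normingTuples [FiniteDimensional ℝ E] : IsCompact (normingTuples L) := by
  have hspheres := isCompact_univ_pi fun _ : ι => isCompact_sphere (0 : E) 1
  convert hspheres.inter_right (isClosed_eq L.cont.abs (continuous_const (y := ‖L‖))) using 1
  ext v
  simp [normingTuples]

theorem normingTuples_nonempty [FiniteDimensional ℝ E] [Nontrivial E] :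
    (normingTuples L).Nonempty := by
  obtain ⟨e, he⟩ := exists_norm_eq E zero_le_one
  have hspheres := isCompact_univ_pi fun _ : ι => isCompact_sphere (0 : E) 1
  obtain ⟨v, hv, hmax⟩ := hspheres.exists_isMaxOn ⟨fun _ => e, by simp [he]⟩
    L.cont.abs.continuousOn
  have hv1 (i : ι) : ‖v i‖ = 1 := by simpa using hv i trivial
  refine ⟨v, hv1, (abs_le_opNorm_of_forall_norm_eq_one hv1).antisymm ?_⟩
  exact opNorm_le_of_forall_norm_eq_one (abs_nonneg _) fun w hw => hmax fun i _ => by simp [hw i]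

theorem update_neg_mem_normingTuples [DecidableEq ι] (hv : v ∈ normingTuples L) (i : ι) :
    update v i (-v i) ∈ normingTuples L := by
  refine ⟨fun k => ?_, ?_⟩
  · rcases eq_or_ne k i with rfl | hk
    · simp [hv.1 k]
    · simp [hk, hv.1 k]
  · rw [← neg_one_smul ℝ (v i), L.map_update_smul, update_eq_self]
    simpa using hv.2

theorem update_midpoint_mem_normingTuples [DecidableEq ι]
    (hL : ∀ (σ : Equiv.Perm ι) (v : ι → E), L (v ∘ σ) = L v) (hv : v ∈ normingTuples L) {i j : ι}
    (hij : i ≠ j) (hw : v i + v j ≠ 0) :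
    update (update v i (‖v i + v j‖⁻¹ • (v i + v j))) j (‖v i + v j‖⁻¹ • (v i + v j))
      ∈ normingTuples L := by
  have hprod (x : E) : ∏ k, ‖update (update v i x) j x k‖ = ‖x‖ ^ 2 := by
    rw [Fintype.prod_eq_mul i j hij fun k hk => by simp [hk.1, hk.2, hv.1 k]]
    simp [hij, sq]
  have hbound (x : E) : |slotForm L v hij x x| ≤ ‖L‖ * ‖x‖ ^ 2 := by
    rw [← hprod]; exact L.le_opNorm _
  have hmid := mul_norm_add_sq_le_abs_bilinForm (slotForm_isSymm hL v hij) hbound (hv.1 i) (hv.1 j)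
    (by simp [slotForm, hv.2])
  set w := v i + v j
  have hunit : ‖‖w‖⁻¹ • w‖ = 1 := by simp [norm_smul, hw]
  have hunits (k : ι) : ‖update (update v i (‖w‖⁻¹ • w)) j (‖w‖⁻¹ • w) k‖ = 1 := by
    rcases eq_or_ne k j with rfl | hkj
    · simpa using hunit
    rcases eq_or_ne k i with rfl | hki
    · simpa [hkj] using hunit
    simp [hkj, hki, hv.1 k]
  refine ⟨hunits, (abs_le_opNorm_of_forall_norm_eq_one hunits).antisymm ?_⟩
  have heval : slotForm L v hij (‖w‖⁻¹ • w) (‖w‖⁻¹ • w)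
      = (‖w‖ ^ 2)⁻¹ * slotForm L v hij w w := by
    simp only [map_smul, LinearMap.smul_apply, smul_eq_mul]
    ring
  change ‖L‖ ≤ |slotForm L v hij (‖w‖⁻¹ • w) (‖w‖⁻¹ • w)|
  rw [heval, abs_mul, abs_of_nonneg (by positivity), le_inv_mul_iff₀ (by positivity)]
  linarith

theorem one_le_inner_sum_of_isMaxOn (hv : v ∈ normingTuples L)
    (hmax : IsMaxOn (fun v => ‖∑ k, v k‖) (normingTuples L) v) (i : ι) :
    1 ≤ ⟪∑ k, v k, v i⟫ := by
  classical
  have hflip : ∑ k, update v i (-v i) k = ∑ k, v k - (2 : ℝ) • v i := by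
    rw [Finset.sum_update_of_mem (Finset.mem_univ i),
      Finset.sum_eq_add_sum_sdiff_singleton_of_mem (Finset.mem_univ i) v, two_smul]
    abel
  have hle : ‖∑ k, v k - (2 : ℝ) • v i‖ ≤ ‖∑ k, v k‖ := by
    rw [← hflip]; exact hmax (update_neg_mem_normingTuples hv i)
  have hsq := pow_le_pow_left₀ (norm_nonneg _) hle 2
  rw [norm_sub_sq_real, norm_smul, inner_smul_right, hv.1 i, Real.norm_two] at hsq
  linarith

theorem eq_of_isMaxOn_norm_sum (hL : ∀ (σ : Equiv.Perm ι) (v : ι → E), L (v ∘ σ) = L v)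
    (hv : v ∈ normingTuples L)
    (hmax : IsMaxOn (fun v => ‖∑ k, v k‖) (normingTuples L) v) (i j : ι) : v i = v j := by
  classical
  rcases eq_or_ne i j with rfl | hij
  · rfl
  have hinner : 2 ≤ ⟪∑ k, v k, v i + v j⟫ := by
    rw [inner_add_right]
    linarith [one_le_inner_sum_of_isMaxOn hv hmax i, one_le_inner_sum_of_isMaxOn hv hmax j]
  have hw : v i + v j ≠ 0 := fun h => by norm_num [h] at hinner
  have hmid := hmax (update_midpoint_mem_normingTuples hL hv hij hw)
  set w := v i + v j with hw_def
  set s := ∑ k, v k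
  have hpos : 0 < ‖w‖ := norm_pos_iff.2 hw
  have hc : ∑ k, update (update v i (‖w‖⁻¹ • w)) j (‖w‖⁻¹ • w) k
      = s + (2 * ‖w‖⁻¹ - 1) • w := by rw [sum_update_update v hij]; module
  have hle : ‖s + (2 * ‖w‖⁻¹ - 1) • w‖ ≤ ‖s‖ := hc ▸ hmid
  have hsq := pow_le_pow_left₀ (norm_nonneg _) hle 2
  rw [norm_add_sq_real, norm_smul, inner_smul_right] at hsq
  have hcoef : 2 * ‖w‖⁻¹ - 1 ≤ 0 := by
    by_contra! hcon
    nlinarith [mul_pos hcon (two_pos.trans_le hinner), sq_nonneg (‖2 * ‖w‖⁻¹ - 1‖ * ‖w‖)]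
  have htwo : 2 ≤ ‖w‖ := by
    rwa [sub_nonpos, ← div_eq_mul_inv, div_le_one hpos] at hcoef
  refine (sameRay_iff_of_norm_eq ((hv.1 i).trans (hv.1 j).symm)).1 (sameRay_iff_norm_add.2 ?_)
  refine (norm_add_le _ _).antisymm ?_
  rw [hv.1 i, hv.1 j, ← hw_def]
  linarith

theorem exists_abs_const_eq_opNorm [FiniteDimensional ℝ E] [Nontrivial E]
    (hL : ∀ (σ : Equiv.Perm ι) (v : ι → E), L (v ∘ σ) = L v) :
    ∃ h : E, ‖h‖ = 1 ∧ |L fun _ => h| = ‖L‖ := by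
  obtain ⟨v, hv, hmax⟩ := isCompact_normingTuples.exists_isMaxOn
    (normingTuples_nonempty (L := L)) (f := fun v => ‖∑ k, v k‖) (by fun_prop)
  rcases isEmpty_or_nonempty ι with hι | ⟨⟨i⟩⟩
  · obtain ⟨e, he⟩ := exists_norm_eq E zero_le_one
    exact ⟨e, he, by rw [← hv.2, Subsingleton.elim v fun _ => e]⟩
  · have hconst : v = fun _ => v i := funext fun k => eq_of_isMaxOn_norm_sum hL hv hmax k i
    exact ⟨v i, hv.1 i, hconst ▸ hv.2⟩

/-- **Banach's theorem** for symmetric multilinear forms. -/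
theorem opNorm_le_of_forall_abs_const_le [Nontrivial E]
    (hL : ∀ (σ : Equiv.Perm ι) (v : ι → E), L (v ∘ σ) = L v) {M : ℝ}
    (hM : ∀ h : E, ‖h‖ = 1 → |L fun _ => h| ≤ M) : ‖L‖ ≤ M := by
  obtain ⟨e, he⟩ := exists_norm_eq E zero_le_one
  refine opNorm_le_of_forall_norm_eq_one ((abs_nonneg _).trans (hM e he)) fun v hv => ?_
  let W := Submodule.span ℝ (insert e (Set.range v))
  have : FiniteDimensional ℝ W := .span_of_finite ℝ ((Set.finite_range v).insert e)
  have heW : e ∈ W := Submodule.subset_span (Set.mem_insert e _)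
  have hvW (i : ι) : v i ∈ W :=
    Submodule.subset_span (Set.mem_insert_of_mem e (Set.mem_range_self i))
  have : Nontrivial W :=
    nontrivial_of_ne ⟨e, heW⟩ 0 fun h => by
      have he0 : e = 0 := congrArg Subtype.val h
      simp [he0] at he
  let LW := L.compContinuousLinearMap fun _ => W.subtypeL
  obtain ⟨h, hh, hLW⟩ := exists_abs_const_eq_opNorm (L := LW) fun σ w => hL σ fun i => w i
  calc |L v| = |LW fun i => ⟨v i, hvW i⟩| := rfl
    _ ≤ ‖LW‖ := abs_le_opNorm_of_forall_norm_eq_one hv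
    _ = |L fun _ => (h : E)| := hLW.symm
    _ ≤ M := hM h hh

end SymmetricMultilinearForms

section FlatAtOrigin

variable {E G : Type*} [NormedAddCommGroup E] [NormedAddCommGroup G] {F : E → G} {C q r : ℝ}

theorem continuousAt_zero_of_norm_le_rpow (hr : 0 < r) (hF : ∀ x, ‖F x‖ ≤ C * ‖x‖ ^ r) :
    ContinuousAt F 0 := by
  have hF0 : F 0 = 0 := by simpa [Real.zero_rpow hr.ne'] using hF 0
  have hbound : Tendsto (fun x : E => C * ‖x‖ ^ r) (𝓝 0) (𝓝 0) := by
    have hcont : Continuous fun x : E => C * ‖x‖ ^ r :=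
      continuous_const.mul (continuous_norm.rpow_const fun _ => Or.inr hr.le)
    simpa [Real.zero_rpow hr.ne'] using hcont.tendsto 0
  rw [ContinuousAt, hF0]
  exact squeeze_zero_norm hF hbound

variable [NormedSpace ℝ E] [NormedSpace ℝ G]

theorem hasFDerivAt_zero_of_norm_le_rpow (hr : 1 < r) (hF : ∀ x, ‖F x‖ ≤ C * ‖x‖ ^ r) :
    HasFDerivAt F (0 : E →L[ℝ] G) 0 := by
  have hF0 : F 0 = 0 := by simpa [Real.zero_rpow (one_pos.trans hr).ne'] using hF 0
  have hrpow : (fun x : E => ‖x‖ ^ r) =o[𝓝 0] fun x : E => x := by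
    have := (hasFDerivAt_norm_rpow (0 : ℝ) hr).isLittleO.comp_tendsto (tendsto_norm_zero (E := E))
    refine Asymptotics.isLittleO_norm_right.1 ?_
    simpa [Function.comp_def, Real.zero_rpow (one_pos.trans hr).ne'] using this
  refine .of_isLittleO ?_
  simpa [hF0] using (Asymptotics.IsBigO.of_bound C (.of_forall fun x => by
    simpa [abs_of_nonneg (Real.rpow_nonneg (norm_nonneg x) r)] using hF x)).trans_isLittleO hrpow

variable {p : ℕ}

theorem iteratedFDeriv_zero_of_norm_le_rpow (hpq : p < q) (hF0 : F 0 = 0)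
    (hbound : ∀ m ≤ p, ∃ C, ∀ x, x ≠ 0 → ‖iteratedFDeriv ℝ m F x‖ ≤ C * ‖x‖ ^ (q - m)) :
    iteratedFDeriv ℝ p F 0 = 0 := by
  induction p with
  | zero => ext v; simpa using hF0
  | succ p ih =>
    push_cast at hpq
    have hzero := ih (by linarith) fun m hm => hbound m (by lia)
    obtain ⟨C, hC⟩ := hbound p p.le_succ
    have hderiv : HasFDerivAt (iteratedFDeriv ℝ p F) (0 : E →L[ℝ] _) 0 := by
      refine hasFDerivAt_zero_of_norm_le_rpow (r := q - p) (C := C) (by linarith) fun x => ?_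
      rcases eq_or_ne x 0 with rfl | hx
      · rw [hzero, norm_zero, norm_zero, Real.zero_rpow (by linarith), mul_zero]
      · exact hC x hx
    ext v
    rw [iteratedFDeriv_succ_apply_left, hderiv.fderiv]
    simp

theorem contDiff_of_norm_iteratedFDeriv_le_rpow (hpq : p < q) (hF0 : F 0 = 0)
    (hF : ∀ x, x ≠ 0 → ContDiffAt ℝ p F x)
    (hbound : ∀ m ≤ p, ∃ C, ∀ x, x ≠ 0 → ‖iteratedFDeriv ℝ m F x‖ ≤ C * ‖x‖ ^ (q - m)) :
    ContDiff ℝ p F := by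
  have hbound' (m : ℕ) (hm : m ≤ p) :
      ∃ C, ∀ x, ‖iteratedFDeriv ℝ m F x‖ ≤ C * ‖x‖ ^ (q - m) := by
    have hmq : (m : ℝ) < q := lt_of_le_of_lt (by exact_mod_cast hm) hpq
    obtain ⟨C, hC⟩ := hbound m hm
    refine ⟨C, fun x => ?_⟩
    rcases eq_or_ne x 0 with rfl | hx
    · rw [iteratedFDeriv_zero_of_norm_le_rpow hmq hF0 fun k hk => hbound k (hk.trans hm),
        norm_zero, norm_zero, Real.zero_rpow (sub_pos.2 hmq).ne', mul_zero]
    · exact hC x hx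
  refine contDiff_nat_iff_continuous_differentiable.2 ⟨fun m hm => ?_, fun m hm => ?_⟩
  · have hmp : (m : ℝ) ≤ p := by exact_mod_cast hm
    obtain ⟨C, hC⟩ := hbound' m hm
    refine continuous_iff_continuousAt.2 fun x => ?_
    rcases eq_or_ne x 0 with rfl | hx
    · exact continuousAt_zero_of_norm_le_rpow (by linarith) hC
    · exact (hF x hx).continuousAt_iteratedFDeriv (by exact_mod_cast hm)
  · have hmp : (m : ℝ) + 1 ≤ p := by exact_mod_cast hm
    obtain ⟨C, hC⟩ := hbound' m hm.le
    intro x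
    rcases eq_or_ne x 0 with rfl | hx
    · exact (hasFDerivAt_zero_of_norm_le_rpow (by linarith) hC).differentiableAt
    · exact (hF x hx).differentiableAt_iteratedFDeriv (by exact_mod_cast hm)

end FlatAtOrigin

section NormPowers

open scoped RealInnerProductSpace ContDiff

variable {E : Type*} [NormedAddCommGroup E] [InnerProductSpace ℝ E] {h x : E} {p : ℕ} {q ν : ℝ}

theorem contDiffAt_normPow {n : WithTop ℕ∞} (q : ℝ) (hx : x ≠ 0) :
    ContDiffAt ℝ n (normPow E q) x :=
  (contDiffAt_norm ℝ hx).rpow_const_of_ne (norm_ne_zero_iff.2 hx)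

theorem hasLineDerivAt_inner_left (x : E) (hh : ‖h‖ = 1) :
    HasLineDerivAt ℝ (fun y => ⟪y, h⟫) 1 x h := by
  simpa [hh, real_inner_comm h] using ((innerSL ℝ h).hasFDerivAt (x := x)).hasLineDerivAt h

theorem hasLineDerivAt_norm (hx : x ≠ 0) (h : E) :
    HasLineDerivAt ℝ (fun y => ‖y‖) (⟪x, h⟫ / ‖x‖) x h := by
  have hsqrt :=
    ((hasStrictFDerivAt_norm_sq x).hasFDerivAt.sqrt (by simpa using hx)).hasLineDerivAt h
  simp only [Real.sqrt_sq (norm_nonneg _)] at hsqrt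
  convert hsqrt using 1
  simp
  field_simp

theorem hasLineDerivAt_axial (P : Polynomial ℝ) (s : ℝ) (hh : ‖h‖ = 1) (hx : x ≠ 0) :
    HasLineDerivAt ℝ (axial P.eval s h)
      (axial ((1 - .X ^ 2) * P.derivative + .C s * .X * P : Polynomial ℝ).eval (s - 1) h x)
      x h := by
  have hx0 : ‖x‖ ≠ 0 := norm_ne_zero_iff.2 hx
  have hnorm := hasLineDerivAt_norm hx h
  have hcos := (hasLineDerivAt_inner_left x hh).div hnorm (by simpa using hx)
  have hprod := ((P.hasDerivAt _).comp (0 : ℝ) hcos).mul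
    (hnorm.rpow_const (p := s) (Or.inl (by simpa using hx)))
  refine hprod.congr_deriv ?_
  have hrpow : ‖x‖ ^ s = ‖x‖ ^ (s - 1) * ‖x‖ := by rw [← Real.rpow_add_one hx0, sub_add_cancel]
  simp only [axial, Pi.div_apply, Function.comp_apply, zero_smul, add_zero, Polynomial.eval_add,
    Polynomial.eval_mul, Polynomial.eval_sub, Polynomial.eval_one, Polynomial.eval_pow,
    Polynomial.eval_X, Polynomial.eval_C, hrpow]
  field_simp

theorem iteratedFDeriv_normPow_const (p : ℕ) (q : ℝ) (hh : ‖h‖ = 1) (hx : x ≠ 0) :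
    iteratedFDeriv ℝ p (normPow E q) x (fun _ => h) = axial (gPoly p q).eval (q - p) h x := by
  induction p generalizing x with
  | zero => simp [gPoly, normPow, axial]
  | succ p ih =>
    have hdiff : DifferentiableAt ℝ (iteratedFDeriv ℝ p (normPow E q)) x :=
      (contDiffAt_normPow (n := ∞) q hx).differentiableAt_iteratedFDeriv
        (by exact_mod_cast ENat.natCast_lt_top p)
    have hline : HasLineDerivAt ℝ (fun y => iteratedFDeriv ℝ p (normPow E q) y fun _ => h)
        (iteratedFDeriv ℝ (p + 1) (normPow E q) x fun _ => h) x h :=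
      ((ContinuousMultilinearMap.apply ℝ (fun _ : Fin p => E) ℝ
        fun _ => h).hasFDerivAt.comp x hdiff.hasFDerivAt).hasLineDerivAt h
    have haxial := (hasLineDerivAt_axial (gPoly p q) (q - p) hh hx).congr_of_eventuallyEq
      ((eventually_ne_nhds hx).mono fun y hy => ih hy)
    rw [hline.unique haxial, gPoly_succ, Nat.cast_succ, sub_sub]

theorem exists_abs_gPoly_eval_le (p : ℕ) (q : ℝ) :
    ∃ C, ∀ t, |t| ≤ 1 → |(gPoly p q).eval t| ≤ C := by
  obtain ⟨C, hC⟩ := isCompact_Icc.exists_bound_of_continuousOn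
    (gPoly p q).continuous.continuousOn (s := Set.Icc (-1) 1)
  exact ⟨C, fun t ht => hC t (abs_le.1 ht)⟩

theorem exists_norm_iteratedFDeriv_normPow_le (E : Type*) [NormedAddCommGroup E]
    [InnerProductSpace ℝ E] (p : ℕ) (q : ℝ) :
    ∃ C, ∀ x : E, x ≠ 0 → ‖iteratedFDeriv ℝ p (normPow E q) x‖ ≤ C * ‖x‖ ^ (q - p) := by
  obtain ⟨C, hC⟩ := exists_abs_gPoly_eval_le p q
  refine ⟨C, fun x hx => ?_⟩
  have : Nontrivial E := nontrivial_of_ne x 0 hx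
  refine opNorm_le_of_forall_abs_const_le
    (fun σ v => (contDiffAt_normPow q hx).iteratedFDeriv_comp_perm v σ) fun h hh => ?_
  rw [iteratedFDeriv_normPow_const p q hh hx, axial, abs_mul,
    Real.abs_rpow_of_nonneg (norm_nonneg x), abs_norm]
  gcongr
  exact hC _ (abs_inner_div_norm_le_one hh x)

theorem contDiff_normPow_of_lt (hpq : p < q) : ContDiff ℝ p (normPow E q) :=
  contDiff_of_norm_iteratedFDeriv_le_rpow hpq
    (by simp [normPow, Real.zero_rpow (p.cast_nonneg.trans_lt hpq).ne'])
    (fun _ => contDiffAt_normPow q) fun m _ => exists_norm_iteratedFDeriv_normPow_le E m q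

theorem contDiff_normPow_of_even {n : WithTop ℕ∞} (hp : Even p) : ContDiff ℝ n (normPow E p) := by
  obtain ⟨k, rfl⟩ := hp
  have hpow : normPow E (k + k : ℕ) = fun x => (‖x‖ ^ 2) ^ k := by
    ext x
    rw [normPow, Real.rpow_natCast, ← pow_mul, two_mul]
  rw [hpow]
  exact (contDiff_norm_sq ℝ).pow k

theorem contDiff_normPow_add (hν : 0 ≤ ν) (h : 0 < ν ∨ Even p) :
    ContDiff ℝ p (normPow E (p + ν)) := by
  rcases hν.eq_or_lt with rfl | hν
  · rw [add_zero]
    exact contDiff_normPow_of_even (h.resolve_left (lt_irrefl 0))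
  · exact contDiff_normPow_of_lt (by linarith)

theorem iteratedFDeriv_normPow_zero_of_lt (hpq : p < q) :
    iteratedFDeriv ℝ p (normPow E q) 0 = 0 :=
  iteratedFDeriv_zero_of_norm_le_rpow hpq
    (by simp [normPow, Real.zero_rpow (p.cast_nonneg.trans_lt hpq).ne'])
    fun m _ => exists_norm_iteratedFDeriv_normPow_le E m q

theorem iteratedFDeriv_comp_neg_apply {G : Type*} [NormedAddCommGroup G] [NormedSpace ℝ G]
    (p : ℕ) (f : E → G) (x : E) (v : Fin p → E) :
    iteratedFDeriv ℝ p (fun y => f (-y)) x v = (-1 : ℝ) ^ p • iteratedFDeriv ℝ p f (-x) v := by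
  have hcomp := (ContinuousLinearEquiv.neg ℝ (M := E)).iteratedFDerivWithin_comp_right f
    (s := Set.univ) uniqueDiffOn_univ (x := x) (Set.mem_univ _) p
  rw [Set.preimage_univ, iteratedFDerivWithin_univ, iteratedFDerivWithin_univ] at hcomp
  calc iteratedFDeriv ℝ p (fun y => f (-y)) x v = iteratedFDeriv ℝ p f (-x) fun i => -v i :=
        congrArg (fun L => L v) hcomp
    _ = (-1 : ℝ) ^ p • iteratedFDeriv ℝ p f (-x) v := by
        simpa using (iteratedFDeriv ℝ p f (-x)).map_smul_univ (fun _ => (-1 : ℝ)) v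

/- For `q ≤ p` the point `0` may be one where `normPow E q` is not differentiable, so that this
value of `iteratedFDeriv` is conventional. -/
theorem iteratedFDeriv_normPow_zero_of_odd (hp : Odd p) (q : ℝ) :
    iteratedFDeriv ℝ p (normPow E q) 0 = 0 := by
  ext v
  have hneg := iteratedFDeriv_comp_neg_apply p (normPow E q) 0 v
  rw [show (fun y => normPow E q (-y)) = normPow E q from funext fun y => by simp [normPow],
    neg_zero, hp.neg_one_pow, neg_one_smul, eq_neg_iff_add_eq_zero, add_self_eq_zero] at hneg
  simpa using hneg

theorem iteratedFDeriv_normPow_zero_const_of_even (hp : Even p) (hh : ‖h‖ = 1) :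
    iteratedFDeriv ℝ p (normPow E p) 0 (fun _ => h) = (gPoly p p).eval 0 := by
  have hcont : Continuous fun t : ℝ => iteratedFDeriv ℝ p (normPow E p) (t • h) fun _ => h :=
    ((contDiff_normPow_of_even hp).continuous_iteratedFDeriv'.comp (by fun_prop)).eval_const _
  have hlim : Tendsto (fun t : ℝ => iteratedFDeriv ℝ p (normPow E p) (t • h) fun _ => h) (𝓝[≠] 0)
      (𝓝 (iteratedFDeriv ℝ p (normPow E p) 0 fun _ => h)) := by
    simpa using (hcont.tendsto 0).mono_left nhdsWithin_le_nhds
  refine tendsto_nhds_unique hlim (tendsto_const_nhds.congr' ?_)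
  filter_upwards [self_mem_nhdsWithin] with t ht
  have hth : t • h ≠ 0 := smul_ne_zero ht fun h0 => by simp [h0] at hh
  rw [iteratedFDeriv_normPow_const p p hh hth, axial, sub_self, Real.rpow_zero, mul_one,
    gPoly_self_eval_of_even hp]

theorem iteratedFDeriv_normPow_add_const (hν : 0 ≤ ν) (hh : ‖h‖ = 1) (x : E) :
    iteratedFDeriv ℝ p (normPow E (p + ν)) x (fun _ => h)
      = axial (gPoly p (p + ν)).eval ν h x := by
  rcases ne_or_eq x 0 with hx | rfl
  · rw [iteratedFDeriv_normPow_const p _ hh hx, add_sub_cancel_left]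
  rcases p.even_or_odd with hp | hp
  · rcases hν.eq_or_lt with rfl | hν
    · simp [axial, iteratedFDeriv_normPow_zero_const_of_even hp hh]
    · simp [iteratedFDeriv_normPow_zero_of_lt, axial, hν, Real.zero_rpow hν.ne']
  · simp [iteratedFDeriv_normPow_zero_of_odd hp, axial, gPoly_eval_zero_of_odd hp]

theorem iteratedFDeriv_normPow_add_comp_perm (hν : 0 ≤ ν) (x : E) (σ : Equiv.Perm (Fin p))
    (v : Fin p → E) :
    iteratedFDeriv ℝ p (normPow E (p + ν)) x (v ∘ σ)
      = iteratedFDeriv ℝ p (normPow E (p + ν)) x v := by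
  rcases ne_or_eq x 0 with hx | rfl
  · exact (contDiffAt_normPow _ hx).iteratedFDeriv_comp_perm v σ
  rcases p.even_or_odd with hp | hp
  · rcases hν.eq_or_lt with rfl | hν
    · rw [add_zero]
      exact (contDiff_normPow_of_even hp).contDiffAt.iteratedFDeriv_comp_perm v σ
    · simp [iteratedFDeriv_normPow_zero_of_lt, hν]
  · simp [iteratedFDeriv_normPow_zero_of_odd hp]

theorem holderOnWithConst_iteratedFDeriv_normPow {M : ℝ} (hM : 0 ≤ M) (hν : 0 ≤ ν)
    (haxial : ∀ h : E, ‖h‖ = 1 →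
      HolderOnWithConst M ν (axial (gPoly p (p + ν)).eval ν h) Set.univ) :
    HolderOnWithConst M ν (iteratedFDeriv ℝ p (normPow E (p + ν))) Set.univ := by
  intro x hx y hy
  rcases subsingleton_or_nontrivial E with _ | _
  · rw [Subsingleton.elim y x, sub_self, norm_zero]
    positivity
  refine opNorm_le_of_forall_abs_const_le (fun σ v => ?_) fun h hh => ?_
  · rw [sub_apply, sub_apply, iteratedFDeriv_normPow_add_comp_perm hν,
      iteratedFDeriv_normPow_add_comp_perm hν]
  · rw [sub_apply, iteratedFDeriv_normPow_add_const hν hh, iteratedFDeriv_normPow_add_const hν hh]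
    exact haxial h hh x hx y hy

end NormPowers

section Constants

open Set

variable {p : ℕ} {ν : ℝ}

theorem gPoly_add_eval_zero_nonneg (p : ℕ) (hν0 : 0 ≤ ν) : 0 ≤ (gPoly p (p + ν)).eval 0 :=
  gPoly_eval_nonneg p (by linarith) (by simp)

theorem gPoly_add_eval_zero_le_one (p : ℕ) (hν0 : 0 ≤ ν) :
    (gPoly p (p + ν)).eval 0 ≤ (gPoly p (p + ν)).eval 1 :=
  gPoly_monotoneOn p hν0 (by simp) (by simp) zero_le_one

theorem holderOnWithConst_of_monotoneOn {g : ℝ → ℝ} {H : ℝ} {S : Set ℝ} (hg : MonotoneOn g S)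
    (hH : ∀ s ∈ S, ∀ t ∈ S, s ≤ t → g t - g s ≤ H * (t - s) ^ ν) : HolderOnWithConst H ν g S := by
  intro s hs t ht
  rcases le_total s t with hst | hts
  · rw [Real.norm_of_nonneg (sub_nonneg.2 (hg hs ht hst)), Real.norm_of_nonneg (sub_nonneg.2 hst)]
    exact hH s hs t ht hst
  · rw [norm_sub_rev, norm_sub_rev t, Real.norm_of_nonneg (sub_nonneg.2 (hg ht hs hts)),
      Real.norm_of_nonneg (sub_nonneg.2 hts)]
    exact hH t ht s hs hts

theorem holderOnWithConst_gPoly_eval_one (p : ℕ) (hν0 : 0 ≤ ν) (hν1 : ν ≤ 1) :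
    HolderOnWithConst ((gPoly p (p + ν)).eval 1) ν (gPoly p (p + ν)).eval (Icc 0 1) :=
  holderOnWithConst_of_monotoneOn (gPoly_monotoneOn p hν0) fun _ hs _ ht hst =>
    gPoly_eval_sub_le p hν0 hν1 hs.1 hst ht.2

theorem gPoly_eval_one_mem_upperBounds (p : ℕ) (hν0 : 0 ≤ ν) (hν1 : ν ≤ 1) :
    (gPoly p (p + ν)).eval 1 ∈ upperBounds (holderQuotients p ν) := by
  rintro _ ⟨s, t, hs, hst, ht, rfl⟩
  rw [div_le_iff₀ (Real.rpow_pos_of_pos (sub_pos.2 hst) ν)]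
  exact gPoly_eval_sub_le p hν0 hν1 hs hst.le ht

theorem isLUB_hConst (p : ℕ) (hν0 : 0 ≤ ν) (hν1 : ν ≤ 1) :
    IsLUB (holderQuotients p ν) (hConst p ν) :=
  isLUB_csSup ⟨_, 0, 1, le_rfl, zero_lt_one, le_rfl, rfl⟩
    ⟨_, gPoly_eval_one_mem_upperBounds p hν0 hν1⟩

theorem hConst_nonneg (p : ℕ) (hν0 : 0 ≤ ν) (hν1 : ν ≤ 1) : 0 ≤ hConst p ν := by
  refine (sub_nonneg.2 (gPoly_add_eval_zero_le_one p hν0)).trans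
    ((isLUB_hConst p hν0 hν1).1 ⟨0, 1, le_rfl, zero_lt_one, le_rfl, ?_⟩)
  simp

theorem holderOnWithConst_hConst (p : ℕ) (hν0 : 0 ≤ ν) (hν1 : ν ≤ 1) :
    HolderOnWithConst (hConst p ν) ν (gPoly p (p + ν)).eval (Icc 0 1) := by
  refine holderOnWithConst_of_monotoneOn (gPoly_monotoneOn p hν0) fun s hs t ht hst => ?_
  rcases hst.eq_or_lt with rfl | hst
  · have := hConst_nonneg p hν0 hν1
    rw [sub_self, sub_self]
    positivity
  · rw [← div_le_iff₀ (Real.rpow_pos_of_pos (sub_pos.2 hst) ν)]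
    exact (isLUB_hConst p hν0 hν1).1 ⟨s, t, hs.1, hst, ht.2, rfl⟩

theorem aConst_of_even (hp : Even p) (ν : ℝ) :
    aConst p ν = (gPoly p (p + ν)).eval 0 + hConst p ν := by
  rw [aConst, if_pos hp, gPoly_add_eval_zero_of_even hp]

theorem aTildeConst_of_even (hp : Even p) (ν : ℝ) :
    aTildeConst p ν = (gPoly p (p + ν)).eval 0 + (gPoly p (p + ν)).eval 1 := by
  rw [aTildeConst, if_pos hp, gPoly_add_eval_zero_of_even hp, gPoly_add_eval_one]

theorem aConst_of_odd (hp : Odd p) (ν : ℝ) :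
    aConst p ν = 2 ^ (1 - ν) * (gPoly p (p + ν)).eval 1 := by
  rw [aConst, if_neg (Nat.not_even_iff_odd.2 hp), gPoly_add_eval_one]

theorem aTildeConst_of_odd (hp : Odd p) (ν : ℝ) :
    aTildeConst p ν = 2 ^ (1 - ν) * (gPoly p (p + ν)).eval 1 := by
  rw [aTildeConst, if_neg (Nat.not_even_iff_odd.2 hp), gPoly_add_eval_one]

theorem aConst_nonneg (p : ℕ) (hν0 : 0 ≤ ν) (hν1 : ν ≤ 1) : 0 ≤ aConst p ν := by
  have hzero := gPoly_add_eval_zero_nonneg p hν0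
  have hone := hzero.trans (gPoly_add_eval_zero_le_one p hν0)
  have hH := hConst_nonneg p hν0 hν1
  rcases p.even_or_odd with hp | hp
  · rw [aConst_of_even hp]
    positivity
  · rw [aConst_of_odd hp]
    positivity

theorem aConst_le_aTildeConst (p : ℕ) (hν0 : 0 ≤ ν) (hν1 : ν ≤ 1) :
    aConst p ν ≤ aTildeConst p ν := by
  rcases p.even_or_odd with hp | hp
  · rw [aConst_of_even hp, aTildeConst_of_even hp]
    gcongr
    exact (isLUB_hConst p hν0 hν1).2 (gPoly_eval_one_mem_upperBounds p hν0 hν1)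
  · rw [aConst_of_odd hp, aTildeConst_of_odd hp]

end Constants

section HolderContinuity

open Set
open scoped RealInnerProductSpace

variable {E : Type*} [NormedAddCommGroup E] [InnerProductSpace ℝ E] {h : E} {p : ℕ} {ν M : ℝ}

theorem holderOnWithConst_axial_gPoly (p : ℕ) (hν0 : 0 ≤ ν) (hν1 : ν ≤ 1) (hh : ‖h‖ = 1) :
    HolderOnWithConst (aConst p ν) ν (axial (gPoly p (p + ν)).eval ν h) univ := by
  rcases p.even_or_odd with hp | hp
  · rw [aConst_of_even hp]
    exact holderOnWithConst_axial_of_even hν0 hν1 (gPoly_monotoneOn p hν0)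
      (gPoly_add_eval_zero_nonneg p hν0) (fun t => by simp [gPoly_eval_neg, hp.neg_one_pow])
      (holderOnWithConst_hConst p hν0 hν1) hh
  · rw [aConst_of_odd hp]
    exact holderOnWithConst_axial_of_odd hν0 hν1 (gPoly_monotoneOn p hν0)
      (fun t => by simp [gPoly_eval_neg, hp.neg_one_pow])
      (holderOnWithConst_gPoly_eval_one p hν0 hν1) hh

theorem holderOnWithConst_aConst (E : Type*) [NormedAddCommGroup E] [InnerProductSpace ℝ E]
    (p : ℕ) (hν0 : 0 ≤ ν) (hν1 : ν ≤ 1) :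
    HolderOnWithConst (aConst p ν) ν (iteratedFDeriv ℝ p (normPow E (p + ν))) univ :=
  holderOnWithConst_iteratedFDeriv_normPow (aConst_nonneg p hν0 hν1) hν0
    fun _ => holderOnWithConst_axial_gPoly p hν0 hν1

theorem axial_self (g : ℝ → ℝ) (s : ℝ) (hh : ‖h‖ = 1) : axial g s h h = g 1 := by
  simp [axial, hh]

theorem axial_neg_self (g : ℝ → ℝ) (s : ℝ) (hh : ‖h‖ = 1) : axial g s h (-h) = g (-1) := by
  simp [axial, hh]

theorem norm_axial_sub_le_of_holderOnWithConst {S : Set E} (hν : 0 ≤ ν)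
    (hM : HolderOnWithConst M ν (iteratedFDeriv ℝ p (normPow E (p + ν))) S) (hh : ‖h‖ = 1)
    {x y : E} (hx : x ∈ S) (hy : y ∈ S) :
    ‖axial (gPoly p (p + ν)).eval ν h y - axial (gPoly p (p + ν)).eval ν h x‖
      ≤ M * ‖y - x‖ ^ ν := by
  rw [← iteratedFDeriv_normPow_add_const hν hh, ← iteratedFDeriv_normPow_add_const hν hh,
    ← sub_apply]
  exact (abs_le_opNorm_of_forall_norm_eq_one fun _ => hh).trans (hM x hx y hy)

theorem aTildeConst_le_of_odd [Nontrivial E] (hν : 0 ≤ ν) (hp : Odd p)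
    (hM : HolderOnWithConst M ν (iteratedFDeriv ℝ p (normPow E (p + ν))) {0}ᶜ) :
    aTildeConst p ν ≤ M := by
  obtain ⟨h, hh⟩ := exists_norm_eq E zero_le_one
  have hne : h ≠ 0 := fun h0 => by simp [h0] at hh
  have hle := (le_abs_self _).trans (norm_axial_sub_le_of_holderOnWithConst hν hM hh
    (x := -h) (y := h) (by simpa using hne) (by simpa using hne))
  rw [axial_self _ _ hh, axial_neg_self _ _ hh, gPoly_eval_neg, hp.neg_one_pow, neg_one_mul,
    sub_neg_eq_add, sub_neg_eq_add, ← two_mul, ← two_smul ℝ h, norm_smul, hh, mul_one,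
    Real.norm_ofNat] at hle
  rw [aTildeConst_of_odd hp, Real.rpow_sub two_pos, Real.rpow_one, div_mul_eq_mul_div]
  exact (div_le_iff₀ (Real.rpow_pos_of_pos two_pos ν)).2 hle

theorem aTildeConst_le_two_mul_of_even [Nontrivial E] (hν : 0 < ν) (hp : Even p)
    (hM : HolderOnWithConst M ν (iteratedFDeriv ℝ p (normPow E (p + ν))) univ) :
    aTildeConst p ν ≤ 2 * M := by
  obtain ⟨h, hh⟩ := exists_norm_eq E zero_le_one
  have hle := (le_abs_self _).trans (norm_axial_sub_le_of_holderOnWithConst hν.le hM hh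
    (mem_univ 0) (mem_univ h))
  have hzero : axial (gPoly p (p + ν)).eval ν h 0 = 0 := by simp [axial, Real.zero_rpow hν.ne']
  rw [axial_self _ _ hh, hzero, sub_zero, sub_zero, hh, Real.one_rpow, mul_one] at hle
  rw [aTildeConst_of_even hp]
  linarith [gPoly_add_eval_zero_le_one p hν.le]

end HolderContinuity

end NormPower

theorem mainTheorem1_general {E : Type*} [NormedAddCommGroup E] [InnerProductSpace ℝ E]
    (p : ℕ) (ν : ℝ) (hν0 : 0 ≤ ν) (hν1 : ν ≤ 1) :
    ((0 < ν ∨ Even p) → ContDiff ℝ p (normPow E (p + ν))) ∧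
    (∀ x : E, x ≠ 0 → ContDiffAt ℝ p (normPow E (p + ν)) x) ∧
    IsLUB (holderQuotients p ν) (hConst p ν) ∧
    HolderOnWithConst (aConst p ν) ν (iteratedFDeriv ℝ p (normPow E (p + ν))) Set.univ ∧
    aConst p ν ≤ aTildeConst p ν ∧
    HolderOnWithConst (aTildeConst p ν) ν (iteratedFDeriv ℝ p (normPow E (p + ν))) Set.univ ∧
    (Nontrivial E → Odd p → ∀ M : ℝ,
      HolderOnWithConst M ν (iteratedFDeriv ℝ p (normPow E (p + ν))) {0}ᶜ →
        aTildeConst p ν ≤ M) ∧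
    (Nontrivial E → Even p → 0 < ν → ∀ M : ℝ,
      HolderOnWithConst M ν (iteratedFDeriv ℝ p (normPow E (p + ν))) Set.univ →
        aTildeConst p ν ≤ 2 * M) := by
  have hA := NormPower.holderOnWithConst_aConst E p hν0 hν1
  have hle := NormPower.aConst_le_aTildeConst p hν0 hν1
  exact ⟨NormPower.contDiff_normPow_add hν0,
    fun _ => NormPower.contDiffAt_normPow _,
    NormPower.isLUB_hConst p hν0 hν1,
    hA, hle, NormPower.holderOnWithConst_mono hA hle,
    fun _ hp _ => NormPower.aTildeConst_le_of_odd hν0 hp,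
    fun _ hp hν _ => NormPower.aTildeConst_le_two_mul_of_even hν hp⟩

/-- `D^p f_{p+ν}` is `iteratedFDeriv ℝ p (normPow E (p + ν))`. It is a genuine derivative on all
of `E` if `0 < ν` or `p` is even. If `ν = 0` and `p` is odd it is one on `E \ {0}`, and at the
origin (of a nontrivial `E`) `iteratedFDeriv` takes the conventional value `0`. -/
theorem mainTheorem1 {E : Type*} [NormedAddCommGroup E] [InnerProductSpace ℝ E]
    [FiniteDimensional ℝ E] (p : ℕ) (ν : ℝ) (hν0 : 0 ≤ ν) (hν1 : ν ≤ 1) :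
    -- the `p`-th derivative exists
    ((0 < ν ∨ Even p) → ContDiff ℝ p (normPow E (p + ν))) ∧
    (∀ x : E, x ≠ 0 → ContDiffAt ℝ p (normPow E (p + ν)) x) ∧
    -- `H_{p,ν}` is a genuine (finite) supremum
    IsLUB (holderQuotients p ν) (hConst p ν) ∧
    -- Hölder continuity with constant `A_{p,ν}`, and consequently with `Ã_{p,ν}`
    HolderOnWithConst (aConst p ν) ν (iteratedFDeriv ℝ p (normPow E (p + ν))) Set.univ ∧
    aConst p ν ≤ aTildeConst p ν ∧
    HolderOnWithConst (aTildeConst p ν) ν (iteratedFDeriv ℝ p (normPow E (p + ν))) Set.univ ∧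
    -- for odd `p`, `Ã_{p,ν}` is optimal, already for pairs of nonzero points
    (Nontrivial E → Odd p → ∀ M : ℝ,
      HolderOnWithConst M ν (iteratedFDeriv ℝ p (normPow E (p + ν))) {0}ᶜ →
        aTildeConst p ν ≤ M) ∧
    -- for even `p` and `0 < ν`, `Ã_{p,ν}` is at most twice any admissible constant
    (Nontrivial E → Even p → 0 < ν → ∀ M : ℝ,
      HolderOnWithConst M ν (iteratedFDeriv ℝ p (normPow E (p + ν))) Set.univ →
        aTildeConst p ν ≤ 2 * M) :=
  mainTheorem1_general p ν hν0 hν1
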